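/- Let $Y$ be a locally compact separable metrizable space, let $X$ be a Hausdorff space, and let $q\colon Y\to X$ be a quotient map. Let $\mathrm{Cl}(Y)$ be the set of closed subsets of $Y$ with the Fell topology, whose subbasic open sets are $\{F : F\cap U\neq\emptyset\}$ with $U\subseteq Y$ open and $\{F : F\cap K=\emptyset\}$ with $K\subseteq Y$ compact. Let $Y_*$ be the closure of the set of fibres $\{q^{-1}(x) : x\in X\}$ in the subspace of nonempty members of $\mathrm{Cl}(Y)$, and let $q_*\colon Y_*\to X$ be given by $q_*(F)=q(y)$ for any $y\in F$ (this is well defined). Call a subset $W\subseteq Y_*$ full if $W$ is closed and $q_*(W)=X$. Call a surjective map $f$ irreducible if no proper closed subset of its domain is mapped by $f$ onto its codomain. Let $V$ be the closure in $Y_*$ of the set of singleton fibres of $Y_*$, that is, of $\{F\in Y_* : q_*^{-1}(q_*(F))=\{F\}\}$. If $q_*$ is a closed map, then $V$ is a minimal full subset of $Y_*$ (with respect to inclusion), it is the only minimal full subset of $Y_*$, and the restriction $q_*|_V\colon V\to X$ is an irreducible quotient map. Moreover, if $q$ is a closed map then $q_*$ is a closed map, so that these conclusions hold in particular whenever $q$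 is closed. -/

import Mathlib

open Set Topology

namespace PureQuotient

/-- The hyperspace `Cl(Y)` of all closed subsets of `Y` (the empty set included), as a type of its
own so that it can carry the Fell topology. -/
structure Cl (Y : Type*) [TopologicalSpace Y] where
  /-- the underlying subset of `Y` -/
  carrier : Set Y
  isClosed' : IsClosed carrier

/-- The Fell topology on `Cl(Y)`: a subbase is given by the families of closed sets that meet
a given open set, and the families of closed sets that miss a given compact set. -/
instance Cl.fellTopology (Y : Type*) [TopologicalSpace Y] : TopologicalSpace (Cl Y) :=
  TopologicalSpace.generateFrom
    ({𝒜 | ∃ U : Set Y, IsOpen U ∧ 𝒜 = {F : Cl Y | (F.carrier ∩ U).Nonempty}} ∪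
      {𝒜 | ∃ K : Set Y, IsCompact K ∧ 𝒜 = {F : Cl Y | F.carrier ∩ K = ∅}})

/-- The fibres of `q`, viewed as points of `Cl(Y)`. -/
def fibres {Y X : Type*} [TopologicalSpace Y] (q : Y → X) : Set (Cl Y) :=
  {F | ∃ x : X, F.carrier = q ⁻¹' {x}}

/-- The space `Y_*`: the closure of the set of fibres of `q` among the nonempty closed subsets
of `Y`, with the (relative) Fell topology. -/
def YStar {Y X : Type*} [TopologicalSpace Y] (q : Y → X) : Set (Cl Y) :=
  {F | F ∈ closure (fibres q) ∧ F.carrier.Nonempty}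

/-- The map `q_* : Y_* → X`, sending `F` to `q y` for a point `y ∈ F`; by `qStar_eq` the value does
not depend on `y` when `q` is continuous and `X` is Hausdorff. -/
noncomputable def qStar {Y X : Type*} [TopologicalSpace Y] (q : Y → X) (F : YStar q) : X :=
  q F.2.2.some

theorem qStar_eq {Y X : Type*} [TopologicalSpace Y] [TopologicalSpace X] [T2Space X]
    {q : Y → X} (hq : Continuous q) (F : YStar q) {y : Y} (hy : y ∈ F.1.carrier) :
    qStar q F = q y := by
  by_contra hne
  obtain ⟨U, W, hU, hW, hzU, hyW, hUW⟩ := t2_separation hne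
  have key : ∀ O : Set X, IsOpen O → IsOpen {G : Cl Y | (G.carrier ∩ q ⁻¹' O).Nonempty} :=
    fun O hO => TopologicalSpace.isOpen_generateFrom_of_mem
      (Or.inl ⟨q ⁻¹' O, hO.preimage hq, rfl⟩)
  obtain ⟨G, ⟨⟨a, haG, haU⟩, ⟨b, hbG, hbW⟩⟩, x, hx⟩ :=
    mem_closure_iff.1 F.2.1 _ ((key U hU).inter (key W hW))
      ⟨⟨F.2.2.some, F.2.2.some_mem, hzU⟩, ⟨y, hy, hyW⟩⟩
  rw [hx] at haG hbG
  have hab : q a = q b := by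
    rw [mem_preimage, mem_singleton_iff] at haG hbG
    rw [haG, hbG]
  exact Set.disjoint_left.1 hUW haU (by rw [mem_preimage, ← hab] at hbW; exact hbW)

/-- A subset `W` of the domain of `f` is full if it is closed and `f(W) = X`. -/
def IsFull {A X : Type*} [TopologicalSpace A] (f : A → X) (W : Set A) : Prop :=
  IsClosed W ∧ f '' W = univ

/-- A surjective map `f` is irreducible if no proper closed subset of the domain is mapped
onto the codomain. -/
def IsIrreducibleMap {A X : Type*} [TopologicalSpace A] (f : A → X) : Prop :=
  Function.Surjective f ∧ ∀ W : Set A, IsClosed W → f '' W = univ → W = univ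

/-- The set of singleton fibres of `f`: the points `a` which are alone in their fibre. -/
def singletonFibres {A X : Type*} (f : A → X) : Set A :=
  {a | f ⁻¹' {f a} = {a}}

end PureQuotient

namespace PureQuotient

section Hyperspace

variable {Y : Type*} [TopologicalSpace Y]

/-! A full set meets every fibre of `qStar q`, so it contains all singleton fibres and hence V. It
remains to see that V is full; as `qStar q` is closed, density of the image of the singleton fibres
suffices (`dense_image_singletonFibres`). A point x of X lies under a singleton fibre once it avoids
the frontiers of q(C), for C in a countable family of small compact sets
(`fibre_mem_singletonFibres`). These frontiers are nowhere dense, but X need not be Baire. The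
interiors of the compact sets q(K n), for an exhaustion K of Y, are Baire, and closedness of `qStar
q` makes their union dense (`dense_iUnion_interior_image`). -/

theorem Cl.ext' {F G : Cl Y} (h : F.carrier = G.carrier) : F = G := by
  cases F; cases G; cases h; rfl

theorem Cl.isOpen_setOf_meets {U : Set Y} (hU : IsOpen U) :
    IsOpen {F : Cl Y | (F.carrier ∩ U).Nonempty} :=
  TopologicalSpace.isOpen_generateFrom_of_mem (Or.inl ⟨U, hU, rfl⟩)

theorem Cl.isOpen_setOf_misses {K : Set Y} (hK : IsCompact K) :
    IsOpen {F : Cl Y | F.carrier ∩ K = ∅} :=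
  TopologicalSpace.isOpen_generateFrom_of_mem (Or.inr ⟨K, hK, rfl⟩)

instance Cl.t1Space : T1Space (Cl Y) := by
  refine t1Space_iff_exists_open.2 fun F G hFG => ?_
  by_cases h : F.carrier ⊆ G.carrier
  · obtain ⟨y, hyG, hyF⟩ := Set.not_subset.1 fun h' => hFG (Cl.ext' (h.antisymm h'))
    refine ⟨_, Cl.isOpen_setOf_misses (isCompact_singleton (x := y)), ?_, ?_⟩
    · simpa using hyF
    · simpa using hyG
  · obtain ⟨y, hyF, hyG⟩ := Set.not_subset.1 h
    refine ⟨_, Cl.isOpen_setOf_meets G.isClosed'.isOpen_compl, ⟨y, hyF, hyG⟩, ?_⟩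
    simp

/-- The Fell topology is compact, by Alexander's subbase theorem. -/
instance Cl.compactSpace : CompactSpace (Cl Y) := by
  refine compactSpace_generateFrom rfl fun P hP hcover => ?_
  let 𝒰 : Set (Set Y) := {U | IsOpen U ∧ {F : Cl Y | (F.carrier ∩ U).Nonempty} ∈ P}
  have h𝒰 : IsOpen (⋃₀ 𝒰) := isOpen_sUnion fun U hU => hU.1
  -- `F₀` misses every U in `𝒰`, so only a miss-set of some compact K can cover it; then `𝒰` covers
  -- K.
  let F₀ : Cl Y := ⟨(⋃₀ 𝒰)ᶜ, h𝒰.isClosed_compl⟩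
  obtain ⟨𝒜, h𝒜, hF₀⟩ : F₀ ∈ ⋃₀ P := hcover ▸ mem_univ _
  rcases hP h𝒜 with ⟨U, hU, rfl⟩ | ⟨K, hK, rfl⟩
  · obtain ⟨y, hy, hyU⟩ := hF₀
    exact absurd ⟨U, ⟨hU, h𝒜⟩, hyU⟩ hy
  · have hKU : K ⊆ ⋃₀ 𝒰 := fun y hy => by
      by_contra hn
      have : y ∈ F₀.carrier ∩ K := ⟨hn, hy⟩
      rw [show F₀.carrier ∩ K = ∅ from hF₀] at this
      exact this
    obtain ⟨T, hT, hTfin, hKT⟩ := hK.elim_finite_subcover_image (b := 𝒰) (c := id)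
      (fun U hU => hU.1) (by rwa [sUnion_eq_biUnion] at hKU)
    refine ⟨insert {F : Cl Y | F.carrier ∩ K = ∅}
      ((fun U => {F : Cl Y | (F.carrier ∩ U).Nonempty}) '' T), ?_, (hTfin.image _).insert _, ?_⟩
    · rintro _ (rfl | ⟨U, hU, rfl⟩)
      exacts [h𝒜, (hT hU).2]
    · refine eq_univ_of_forall fun F => ?_
      rcases (F.carrier ∩ K).eq_empty_or_nonempty with h | ⟨y, hyF, hyK⟩
      · exact ⟨_, Or.inl rfl, h⟩
      · obtain ⟨U, hU, hyU⟩ := mem_iUnion₂.1 (hKT hyK)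
        exact ⟨_, Or.inr ⟨U, hU, rfl⟩, y, hyF, hyU⟩

/-- Over a locally compact space, the membership relation is closed. -/
theorem Cl.isClosed_setOf_mem [LocallyCompactSpace Y] :
    IsClosed {z : Cl Y × Y | z.2 ∈ z.1.carrier} := by
  rw [← isOpen_compl_iff, isOpen_iff_mem_nhds]
  rintro ⟨F, y⟩ hy
  obtain ⟨K, hK, hKF, hKc⟩ := local_compact_nhds (F.isClosed'.isOpen_compl.mem_nhds hy)
  have hF : F.carrier ∩ K = ∅ := by
    rw [← disjoint_iff_inter_eq_empty]
    exact disjoint_left.2 fun z hz hzK => hKF hzK hz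
  filter_upwards [prod_mem_nhds ((Cl.isOpen_setOf_misses hKc).mem_nhds hF) hK]
  rintro ⟨G, z⟩ ⟨hG, hz⟩ hzG
  have : z ∈ G.carrier ∩ K := ⟨hzG, hz⟩
  rw [show G.carrier ∩ K = ∅ from hG] at this
  exact this

/-- The union of a closed family of closed sets is closed. -/
theorem Cl.isClosed_biUnion [LocallyCompactSpace Y] {A : Set (Cl Y)} (hA : IsClosed A) :
    IsClosed {y : Y | ∃ F ∈ A, y ∈ F.carrier} := by
  have := isClosedMap_snd_of_compactSpace _
    ((hA.preimage (continuous_fst (Y := Y))).inter Cl.isClosed_setOf_mem)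
  convert this using 1
  ext y
  constructor
  · rintro ⟨F, hF, hy⟩
    exact ⟨(F, y), ⟨hF, hy⟩, rfl⟩
  · rintro ⟨⟨F, z⟩, ⟨hF, hz⟩, rfl⟩
    exact ⟨F, hF, hz⟩

end Hyperspace

/-! ### The map `qStar q` and its singleton fibres -/

section QStar

variable {Y X : Type*} [TopologicalSpace Y] [TopologicalSpace X] [T2Space X] {q : Y → X}

theorem carrier_subset_fibre (hq : Continuous q) (F : YStar q) :
    F.1.carrier ⊆ q ⁻¹' {qStar q F} := fun _ hy => (qStar_eq hq F hy).symm

/-- The fibre of `q` over `x` as a point of `Y_*`. -/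
def fibre (hq : Continuous q) (hs : Function.Surjective q) (x : X) : YStar q :=
  ⟨⟨q ⁻¹' {x}, isClosed_singleton.preimage hq⟩, subset_closure ⟨x, rfl⟩, hs x⟩

theorem qStar_fibre (hq : Continuous q) (hs : Function.Surjective q) (x : X) :
    qStar q (fibre hq hs x) = x := by
  obtain ⟨y, hy⟩ := hs x
  exact (qStar_eq hq (fibre hq hs x) (y := y) hy).trans hy

theorem continuous_qStar (hq : Continuous q) : Continuous (qStar q) := by
  refine continuous_def.2 fun O hO => ?_
  convert (Cl.isOpen_setOf_meets (hO.preimage hq)).preimage continuous_subtype_val using 1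
  ext F
  constructor
  · intro hF
    obtain ⟨y, hy⟩ := F.2.2
    exact ⟨y, hy, by rwa [mem_preimage, ← qStar_eq hq F hy]⟩
  · rintro ⟨y, hy, hyO⟩
    rwa [mem_preimage, qStar_eq hq F hy]

/-- The image of A is q of the union of its members. Taking that union over a closed subfamily of
`Cl Y` is harmless: the empty set contributes no point. -/
theorem isClosedMap_qStar [LocallyCompactSpace Y] (hq : Continuous q) (hc : IsClosedMap q) :
    IsClosedMap (qStar q) := by
  intro A hA
  obtain ⟨B, hB, rfl⟩ := isClosed_induced_iff.1 hA
  convert hc _ (Cl.isClosed_biUnion (hB.inter (isClosed_closure (s := fibres q)))) using 1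
  ext x
  constructor
  · rintro ⟨F, hF, rfl⟩
    obtain ⟨y, hy⟩ := F.2.2
    exact ⟨y, ⟨F.1, ⟨hF, F.2.1⟩, hy⟩, (qStar_eq hq F hy).symm⟩
  · rintro ⟨y, ⟨F, ⟨hF, hF'⟩, hy⟩, rfl⟩
    exact ⟨⟨F, hF', y, hy⟩, hF, qStar_eq hq _ hy⟩

/-- If `x` is not on the boundary of the image of any member of a family of compact sets that
contains arbitrarily small neighbourhoods of all points, then the fibre of `qStar q` over `x`
is a singleton. -/
theorem fibre_mem_singletonFibres (hq : Continuous q) (hs : Function.Surjective q)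
    {𝒞 : Set (Set Y)} (h𝒞 : ∀ C ∈ 𝒞, IsCompact C)
    (hbasis : ∀ y U, IsOpen U → y ∈ U → ∃ C ∈ 𝒞, y ∈ C ∧ C ⊆ U)
    {x : X} (hx : ∀ C ∈ 𝒞, x ∉ frontier (q '' C)) :
    fibre hq hs x ∈ singletonFibres (qStar q) := by
  refine Set.Subset.antisymm (fun F hF => ?_) (by rintro _ rfl; rfl)
  have hFx : qStar q F = x := hF.trans (qStar_fibre hq hs x)
  refine Subtype.ext (Cl.ext' (Set.Subset.antisymm ?_ fun y hy => ?_))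
  · have := carrier_subset_fibre hq F
    rwa [hFx] at this
  · by_contra hyF
    obtain ⟨C, hC, hyC, hCF⟩ := hbasis y _ F.1.isClosed'.isOpen_compl hyF
    have hxC : x ∈ interior (q '' C) := by
      by_contra hn
      exact hx C hC ⟨subset_closure ⟨y, hyC, hy⟩, hn⟩
    have hmiss : F.1.carrier ∩ C = ∅ := by
      rw [← disjoint_iff_inter_eq_empty]
      exact disjoint_left.2 fun z hz hzC => hCF hzC hz
    have hmeet : (F.1.carrier ∩ q ⁻¹' interior (q '' C)).Nonempty := by
      obtain ⟨z, hz⟩ := F.2.2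
      refine ⟨z, hz, ?_⟩
      rwa [mem_preimage, ← qStar_eq hq F hz, hFx]
    -- A fibre G close to F misses C but lies over a point of q(C), which is absurd.
    obtain ⟨G, ⟨hG₁, z, hzG, hzC⟩, x', hx'⟩ := mem_closure_iff.1 F.2.1 _
      ((Cl.isOpen_setOf_misses (h𝒞 C hC)).inter
        (Cl.isOpen_setOf_meets (isOpen_interior.preimage hq))) ⟨hmiss, hmeet⟩
    obtain ⟨c, hc, hcz⟩ := interior_subset hzC
    rw [hx'] at hzG
    have : c ∈ G.carrier ∩ C := ⟨by rw [hx']; exact hcz.trans hzG, hc⟩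
    rw [show G.carrier ∩ C = ∅ from hG₁] at this
    exact this

/-- If `qStar q` is closed, then the interiors of the images of the members of a compact exhaustion
are dense. -/
theorem dense_iUnion_interior_image [FirstCountableTopology Y] (hq : IsQuotientMap q)
    (hc : IsClosedMap (qStar q)) (K : CompactExhaustion Y) :
    Dense (⋃ n, interior (q '' K n)) := by
  rw [dense_iff_inter_open]
  rintro O hO ⟨x, hxO⟩
  by_contra hempty
  have hint : ∀ z ∈ O, ∀ n, z ∉ interior (q '' K n) := fun z hz n hzn =>
    hempty ⟨z, hz, mem_iUnion.2 ⟨n, hzn⟩⟩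
  -- Otherwise the closed image of the sets missing `interior (K n)` omits z, and its complement is
  -- a neighbourhood of z inside q(K n).
  have hfar : ∀ z ∈ O, ∀ n, ∃ F : YStar q, qStar q F = z ∧ F.1.carrier ∩ interior (K n) = ∅ := by
    intro z hz n
    by_contra! hn
    have hcl : IsClosed (qStar q '' {F : YStar q | ¬ (F.1.carrier ∩ interior (K n)).Nonempty}) :=
      hc _ (((Cl.isOpen_setOf_meets isOpen_interior).preimage
        continuous_subtype_val).isClosed_compl)
    refine hint z hz n (mem_interior.2 ⟨_, fun w hw => ?_, hcl.isOpen_compl, ?_⟩)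
    · have hw' : fibre hq.continuous hq.surjective w ∉
          {F : YStar q | ¬ (F.1.carrier ∩ interior (K n)).Nonempty} :=
        fun h => hw ⟨_, h, qStar_fibre _ _ w⟩
      obtain ⟨y, hy, hyK⟩ := not_not.1 hw'
      exact ⟨y, interior_subset hyK, hy⟩
    · rintro ⟨F, hF, rfl⟩
      exact hF (hn F rfl)
  have hnotopen : ¬ IsOpen ({x} : Set X) := fun hopen => by
    obtain ⟨y, rfl⟩ := hq.surjective x
    obtain ⟨n, hn⟩ := K.exists_mem y
    exact hint _ hxO n (mem_interior.2
      ⟨_, singleton_subset_iff.2 (mem_image_of_mem q hn), hopen, rfl⟩)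
  -- As q is a quotient map and x is not isolated, the fibre over x is not open.
  obtain ⟨y, hyx, hy⟩ : ∃ y, q y = x ∧ y ∈ closure (q ⁻¹' {x}ᶜ) := by
    by_contra! hn
    refine hnotopen (hq.isOpen_preimage.1 (isOpen_iff_mem_nhds.2 fun y hy => ?_))
    have := hn y hy
    rwa [preimage_compl, closure_compl, notMem_compl_iff, mem_interior_iff_mem_nhds] at this
  obtain ⟨u, hu, hlim⟩ := mem_closure_iff_seq_limit.1 hy
  have hlim' : Filter.Tendsto (q ∘ u) Filter.atTop (𝓝 x) :=
    hyx ▸ (hq.continuous.tendsto y).comp hlim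
  obtain ⟨N, hN⟩ := Filter.eventually_atTop.1 (hlim' (hO.mem_nhds hxO))
  choose F hF hFK using fun k : ℕ => hfar _ (hN (N + k) (Nat.le_add_right N k)) k
  -- The `F k` escape to infinity: G meets the interior of some K (n + 1), which `F k` misses for k
  -- ≥ n + 1.
  have hlf : LocallyFinite fun k => ({F k} : Set (YStar q)) := by
    intro G
    obtain ⟨z, hz⟩ := G.2.2
    obtain ⟨n, hn⟩ := K.exists_mem z
    refine ⟨_, ((Cl.isOpen_setOf_meets isOpen_interior).preimage
      continuous_subtype_val).mem_nhds ⟨z, hz, K.subset_interior_succ n hn⟩,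
      (finite_lt_nat (n + 1)).subset ?_⟩
    rintro k ⟨_, rfl, w, hw, hwK⟩
    by_contra hk
    have : w ∈ (F k).1.carrier ∩ interior (K k) :=
      ⟨hw, interior_mono (K.subset (not_lt.1 hk)) hwK⟩
    rw [hFK k] at this
    exact this
  -- The values of `qStar q` on the `F k` thus form a closed set, which contains their limit x
  -- although none of them equals x.
  have hcl := hc _ (hlf.isClosed_iUnion fun k => isClosed_singleton)
  have hxmem : x ∈ qStar q '' ⋃ k, {F k} := by
    refine hcl.mem_of_tendsto (hlim'.comp (Filter.tendsto_add_atTop_nat N))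
      (Filter.Eventually.of_forall fun k => ⟨F k, mem_iUnion.2 ⟨k, rfl⟩, ?_⟩)
    rw [hF, add_comm N k]
    rfl
  obtain ⟨_, hG, hGx⟩ := hxmem
  obtain ⟨k, rfl⟩ := mem_iUnion.1 hG
  exact hu (N + k) ((hF k).symm.trans hGx)

end QStar

/-! ### Baire category -/

theorem baireSpace_interior {X : Type*} [TopologicalSpace X] [T2Space X] {L : Set X}
    (hL : IsCompact L) : BaireSpace (interior L) := by
  have := isCompact_iff_compactSpace.1 hL
  have hemb : IsOpenEmbedding (inclusion (interior_subset (s := L))) := by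
    refine ⟨.inclusion interior_subset, ?_⟩
    rw [range_inclusion]
    exact isOpen_interior.preimage continuous_subtype_val
  exact hemb.baireSpace

/-- The compact closures of members of a countable base suffice, by local compactness. -/
theorem exists_countable_compact_network (Y : Type*) [TopologicalSpace Y] [LocallyCompactSpace Y]
    [SecondCountableTopology Y] [T2Space Y] :
    ∃ 𝒞 : Set (Set Y), 𝒞.Countable ∧ (∀ C ∈ 𝒞, IsCompact C) ∧
      ∀ y U, IsOpen U → y ∈ U → ∃ C ∈ 𝒞, y ∈ C ∧ C ⊆ U := by
  refine ⟨{C | IsCompact C} ∩ closure '' TopologicalSpace.countableBasis Y,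
    ((TopologicalSpace.countable_countableBasis Y).image _).mono inter_subset_right,
    fun C hC => hC.1, fun y U hU hy => ?_⟩
  obtain ⟨K, hK, hKU, hKc⟩ := local_compact_nhds (hU.mem_nhds hy)
  obtain ⟨B, hB, hyB, hBK⟩ := (TopologicalSpace.isBasis_countableBasis Y).mem_nhds_iff.1 hK
  have hcl : closure B ⊆ K := closure_minimal hBK hKc.isClosed
  exact ⟨_, ⟨hKc.of_isClosed_subset isClosed_closure hcl, mem_image_of_mem _ hB⟩,
    subset_closure hyB, hcl.trans hKU⟩

theorem dense_image_singletonFibres {Y X : Type*} [TopologicalSpace Y] [LocallyCompactSpace Y]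
    [SecondCountableTopology Y] [T2Space Y] [TopologicalSpace X] [T2Space X] {q : Y → X}
    (hq : IsQuotientMap q) (hc : IsClosedMap (qStar q)) :
    Dense (qStar q '' singletonFibres (qStar q)) := by
  obtain ⟨𝒞, hcount, h𝒞, hbasis⟩ := exists_countable_compact_network Y
  let K : CompactExhaustion Y := default
  rw [dense_iff_inter_open]
  intro O hO hne
  obtain ⟨x, hxO, hx⟩ := (dense_iUnion_interior_image hq hc K).inter_open_nonempty O hO hne
  obtain ⟨n, hn⟩ := mem_iUnion.1 hx
  have := baireSpace_interior ((K.isCompact n).image hq.continuous)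
  -- Each q(C) is compact, hence closed, so its frontier has empty interior; density of the
  -- complement passes to an open subspace.
  have hdense : Dense (⋂ C ∈ 𝒞, ((↑) : interior (q '' K n) → X) ⁻¹' (frontier (q '' C))ᶜ) := by
    refine dense_biInter_of_isOpen
      (fun C _ => isClosed_frontier.isOpen_compl.preimage continuous_subtype_val) hcount
      fun C hC => Dense.preimage ?_ isOpen_interior.isOpenMap_subtype_val
    rw [← interior_eq_empty_iff_dense_compl]
    exact interior_frontier ((h𝒞 C hC).image hq.continuous).isClosed
  obtain ⟨z, hzO, hz⟩ := hdense.inter_open_nonempty _ (hO.preimage continuous_subtype_val)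
    ⟨⟨x, hn⟩, hxO⟩
  exact ⟨z, hzO, _, fibre_mem_singletonFibres hq.continuous hq.surjective h𝒞 hbasis
    (fun C hC => mem_iInter₂.1 hz C hC), qStar_fibre _ _ _⟩

/-! ### Full sets and irreducibility -/

section Full

variable {A X : Type*} [TopologicalSpace A] {f : A → X}

theorem IsFull.closure_singletonFibres_subset {W : Set A} (hW : IsFull f W) :
    closure (singletonFibres f) ⊆ W := by
  refine closure_minimal (fun a ha => ?_) hW.1
  obtain ⟨b, hb, hba⟩ : f a ∈ f '' W := hW.2 ▸ mem_univ _
  have : b ∈ f ⁻¹' {f a} := hba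
  rw [show f ⁻¹' {f a} = {a} from ha] at this
  rwa [← mem_singleton_iff.1 this]

theorem isFull_closure_singletonFibres [TopologicalSpace X] (hc : IsClosedMap f)
    (hd : Dense (f '' singletonFibres f)) : IsFull f (closure (singletonFibres f)) := by
  refine ⟨isClosed_closure, ?_⟩
  have := (hd.mono (image_mono subset_closure)).closure_eq
  rwa [(hc _ isClosed_closure).closure_eq] at this

theorem Minimal.isIrreducibleMap_domRestrict {V : Set A} (hV : Minimal (IsFull f) V) :
    IsIrreducibleMap (V.domRestrict f) := by
  refine ⟨fun x => ?_, fun W hW himage => ?_⟩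
  · obtain ⟨a, ha, rfl⟩ : x ∈ f '' V := hV.1.2 ▸ mem_univ _
    exact ⟨⟨a, ha⟩, rfl⟩
  · have hfull : IsFull f ((↑) '' W : Set A) := by
      refine ⟨hV.1.1.isClosedMap_subtype_val _ hW, ?_⟩
      rw [image_image]
      exact himage
    refine eq_univ_of_forall fun a => ?_
    obtain ⟨b, hb, hba⟩ := hV.2 hfull (by rintro _ ⟨b, -, rfl⟩; exact b.2) a.2
    rwa [← Subtype.ext hba]

end Full

end PureQuotient

theorem corollary6p1 {Y X : Type*}
    [TopologicalSpace Y] [LocallyCompactSpace Y] [TopologicalSpace.SeparableSpace Y]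
    [TopologicalSpace.MetrizableSpace Y]
    [TopologicalSpace X] [T2Space X]
    (q : Y → X) (hq : IsQuotientMap q)
    (V : Set (PureQuotient.YStar q))
    (hV : V = closure (PureQuotient.singletonFibres (PureQuotient.qStar q))) :
    (IsClosedMap q → IsClosedMap (PureQuotient.qStar q)) ∧
    (IsClosedMap (PureQuotient.qStar q) →
      (Minimal (PureQuotient.IsFull (PureQuotient.qStar q)) V ∧
        ∀ W : Set (PureQuotient.YStar q),
          Minimal (PureQuotient.IsFull (PureQuotient.qStar q)) W → W = V) ∧
      IsQuotientMap (V.domRestrict (PureQuotient.qStar q)) ∧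
      PureQuotient.IsIrreducibleMap (V.domRestrict (PureQuotient.qStar q))) := by
  subst hV
  let _ := TopologicalSpace.metrizableSpaceMetric Y
  have := UniformSpace.secondCountable_of_separable Y
  refine ⟨PureQuotient.isClosedMap_qStar hq.continuous, fun hc => ?_⟩
  have hfull := PureQuotient.isFull_closure_singletonFibres hc
    (PureQuotient.dense_image_singletonFibres hq hc)
  have hmin : Minimal (PureQuotient.IsFull (PureQuotient.qStar q))
      (closure (PureQuotient.singletonFibres (PureQuotient.qStar q))) :=
    ⟨hfull, fun W hW _ => hW.closure_singletonFibres_subset⟩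
  have hirr := PureQuotient.Minimal.isIrreducibleMap_domRestrict hmin
  refine ⟨⟨hmin, fun W hW => ?_⟩, ?_, hirr⟩
  · exact (hW.2 hfull hW.1.closure_singletonFibres_subset).antisymm
      hW.1.closure_singletonFibres_subset
  · exact (hc.domRestrict isClosed_closure).isQuotientMap
      ((PureQuotient.continuous_qStar hq.continuous).comp continuous_subtype_val) hirr.1
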